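/- Let $T>0$ and let $X=(X_t)_{t\in[0,T]}$ be a continuous centered Gaussian semimartingale with $X_0=0$ on a probability space $(\Omega,\mathcal A,\mathbb P)$, with natural filtration $\mathcal F^X_s=\sigma(X_u,\ u\le s)$ (the semimartingale property may be meant with respect to $\mathcal F^X$, its completion, or any other filtration $\mathbb F$ on $[0,T]$). Let $I$ be a finite index set, let $f_i:[0,T]\to\mathbb R$ ($i\in I$) be bounded Borel functions, and put $Z_T^i=\int_0^T f_i(u)\,dX_u$ (stochastic integral) and $\overline Z_T=(Z_T^i)_{i\in I}$, a random vector in the Euclidean space $\mathbb R^I$. For $s\in[0,T)$ let $$Q(s,T)=\Big(\mathbb E\big[(Z^i_T-\mathbb E[Z^i_T\mid\mathcal F^X_s])(Z^j_T-\mathbb E[Z^j_T\mid\mathcal F^X_s])\,\big|\,\mathcal F^X_s\big]\Big)_{i,j\in I}$$ be the conditional covariance matrix of $\overline Z_T$ given $\mathcal F^X_s$, and assume $(\mathcal H)$: for every $s\in[0,T)$, the matrix $Q(s,T)$ is almost surely invertible. Let $\gamma_1,\dots,\gamma_N\in\mathbb R^I$ be pairwise distinct, let $C_1,\dots,C_N$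 be an associated Voronoi partition of $\mathbb R^I$ (a Borel partition such that $|z-\gamma_i|\le|z-\gamma_j|$ for all $z\in C_i$ and all $i,j$), and assume that $\widehat Z^\Gamma=\sum_{i=1}^N\gamma_i\mathbf 1_{C_i}(\overline Z_T)$ is a stationary quantizer of $\overline Z_T$, i.e. $\widehat Z^\Gamma=\mathbb E[\overline Z_T\mid\widehat Z^\Gamma]$ almost surely. Then for every $s\in[0,T)$ and every $k\in\{1,\dots,N\}$ one has $\mathbb P[\widehat Z^\Gamma=\gamma_k]>0$, and the conditional probability $\mathbb P[\,\cdot\mid\widehat Z^\Gamma=\gamma_k]$ is equivalent to $\mathbb P$ on $\mathcal F^X_s$ (they have the same null sets in $\mathcal F^X_s$). -/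

import Mathlib

open MeasureTheory ProbabilityTheory Filter Topology
open scoped ENNReal

noncomputable section

namespace GaussianStrat

instance factNonnegOfPos {T : ℝ} [h : Fact (0 < T)] : Fact (0 ≤ T) := ⟨h.out.le⟩

/-- The compact time interval `[0, T]`; for `0 < T` its elements `⊥`, `⊤` are the times `0`, `T`. -/
abbrev Time (T : ℝ) : Type := Set.Icc (0 : ℝ) T

section Integration

variable {T : ℝ} [Fact (0 < T)] {Ω : Type*} {mΩ : MeasurableSpace Ω}

/-- Almost all paths of the process are continuous on `[0, T]`. -/
def HasContinuousPaths (Y : Time T → Ω → ℝ) (P : Measure Ω) : Prop :=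
  ∀ᵐ ω ∂P, Continuous fun t => Y t ω

/-- Local martingale on `[0, T]`: the localizing stopping times take values in `[0, T] ∪ {∞}` and
almost surely are eventually `∞`. -/
def IsLocalMartingale (𝔽 : Filtration (Time T) mΩ) (P : Measure Ω) (M : Time T → Ω → ℝ) : Prop :=
  Locally (fun Y => Martingale Y 𝔽 P) 𝔽 M P

/-- Continuous local martingale on `[0, T]` started at `0`. -/
structure IsContinuousLocalMartingale (𝔽 : Filtration (Time T) mΩ) (P : Measure Ω)
    (M : Time T → Ω → ℝ) : Prop where
  localMartingale : IsLocalMartingale 𝔽 P M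
  continuousPaths : HasContinuousPaths M P
  start : ∀ᵐ ω ∂P, M ⊥ ω = 0

/-- Continuous adapted process on `[0, T]` with paths of bounded variation, started at `0`. -/
structure IsContinuousFiniteVariation (𝔽 : Filtration (Time T) mΩ) (P : Measure Ω)
    (V : Time T → Ω → ℝ) : Prop where
  adapted : StronglyAdapted 𝔽 V
  continuousPaths : HasContinuousPaths V P
  boundedVariation : ∀ᵐ ω ∂P, BoundedVariationOn (fun t => V t ω) Set.univ
  start : ∀ᵐ ω ∂P, V ⊥ ω = 0

/-- Canonical decomposition `X = M + V` of a continuous semimartingale `X` with `X₀ = 0`. -/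
structure IsCanonicalDecomposition (𝔽 : Filtration (Time T) mΩ) (P : Measure Ω)
    (X M V : Time T → Ω → ℝ) : Prop where
  martingalePart : IsContinuousLocalMartingale 𝔽 P M
  variationPart : IsContinuousFiniteVariation 𝔽 P V
  eq_add : ∀ᵐ ω ∂P, ∀ t, X t ω = M t ω + V t ω

/-- `X` is a continuous `𝔽`-semimartingale on `[0, T]` with `X₀ = 0`. -/
def IsContinuousSemimartingale (𝔽 : Filtration (Time T) mΩ) (P : Measure Ω)
    (X : Time T → Ω → ℝ) : Prop :=
  ∃ M V, IsCanonicalDecomposition 𝔽 P X M V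

/-- `A` is the quadratic variation `⟨M⟩` of the continuous local martingale `M` (with `M₀ = 0`):
the continuous adapted nondecreasing process with `A₀ = 0` such that `M² - A` is a local
martingale. -/
structure IsQuadraticVariation (𝔽 : Filtration (Time T) mΩ) (P : Measure Ω)
    (M A : Time T → Ω → ℝ) : Prop where
  adapted : StronglyAdapted 𝔽 A
  continuousPaths : HasContinuousPaths A P
  monotone : ∀ᵐ ω ∂P, Monotone fun t => A t ω
  start : ∀ᵐ ω ∂P, A ⊥ ω = 0
  localMartingale : IsLocalMartingale 𝔽 P fun t ω => M t ω ^ 2 - A t ω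

open Classical in
/-- The total variation measure `|dv|` on `[0, T]` of a continuous path `v` of bounded variation,
`|dv|((a, b])` being the variation of `v` on `[a, b]`. For nondecreasing `v` this is the
Stieltjes measure `dv`. -/
def variationMeasure (v : Time T → ℝ) : Measure (Time T) :=
  if h : BoundedVariationOn v Set.univ then (h.stieltjesFunctionRightLim ⊥).measure else 0

/-- Deterministic step function `∑ i, c i • 1_{(a i, b i]}` on `[0, T]`. -/
structure StepFunction (T : ℝ) where
  /-- number of terms -/
  n : ℕ
  /-- coefficients -/
  c : Fin n → ℝ
  /-- left endpoints -/
  a : Fin n → Time T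
  /-- right endpoints -/
  b : Fin n → Time T
  le : ∀ i, a i ≤ b i

/-- The values of a step function. -/
def StepFunction.eval (h : StepFunction T) (t : Time T) : ℝ :=
  ∑ i, (Set.Ioc (h.a i) (h.b i)).indicator (fun _ => h.c i) t

/-- The elementary integral `∫₀ᵀ h dX = ∑ i, c i (X_{b i} - X_{a i})` of a step function. -/
def StepFunction.integral (h : StepFunction T) (X : Time T → Ω → ℝ) (ω : Ω) : ℝ :=
  ∑ i, h.c i * (X (h.b i) ω - X (h.a i) ω)

/-- `Z` is (a version of) the stochastic integral `∫₀ᵀ f dX` of the deterministic function `f`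
with respect to the continuous semimartingale `X = M + V`: the limit in probability of the
elementary integrals of step functions that converge to `f`, in probability, both in
`L²(d⟨M⟩)` and in `L¹(|dV|)`. -/
def IsStochasticIntegral (𝔽 : Filtration (Time T) mΩ) (P : Measure Ω)
    (X : Time T → Ω → ℝ) (f : Time T → ℝ) (Z : Ω → ℝ) : Prop :=
  ∃ M V A : Time T → Ω → ℝ, IsCanonicalDecomposition 𝔽 P X M V ∧
    IsQuadraticVariation 𝔽 P M A ∧
    ∃ h : ℕ → StepFunction T,
      (∀ ε : ℝ≥0∞, 0 < ε → Tendsto (fun n =>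
        P {ω | ε ≤ ∫⁻ t, ‖(h n).eval t - f t‖ₑ ^ 2 ∂(variationMeasure fun t => A t ω)})
        atTop (𝓝 0)) ∧
      (∀ ε : ℝ≥0∞, 0 < ε → Tendsto (fun n =>
        P {ω | ε ≤ ∫⁻ t, ‖(h n).eval t - f t‖ₑ ∂(variationMeasure fun t => V t ω)})
        atTop (𝓝 0)) ∧
      TendstoInMeasure P (fun n => (h n).integral X) atTop Z

end Integration

section Quantization

variable {Ω : Type*} {mΩ : MeasurableSpace Ω} {ι : Type*} [Fintype ι]

/-- The conditional covariance matrix of `(Z i)` given the sub-σ-algebra `m`: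
the entries are `𝔼[(Zᵢ - 𝔼[Zᵢ | m]) (Zⱼ - 𝔼[Zⱼ | m]) | m]`. -/
def condCovMatrix (P : Measure Ω) (m : MeasurableSpace Ω) (Z : ι → Ω → ℝ) (ω : Ω) :
    Matrix ι ι ℝ :=
  Matrix.of fun i j => (P[fun ω' => (Z i ω' - (P[Z i | m]) ω') * (Z j ω' - (P[Z j | m]) ω') | m]) ω

/-- The random vector `(Z i)` with values in the Euclidean space `ℝ^ι`. -/
def vec (Z : ι → Ω → ℝ) (ω : Ω) : EuclideanSpace ℝ ι := WithLp.toLp 2 fun i => Z i ω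

/-- `C 1, …, C N` is a Voronoi partition of `ℝ^ι` for the pairwise distinct knots
`γ 1, …, γ N`: a Borel partition such that every point of `C i` has `γ i` as a nearest knot. -/
structure IsVoronoiPartition {N : ℕ} (γ : Fin N → EuclideanSpace ℝ ι)
    (C : Fin N → Set (EuclideanSpace ℝ ι)) : Prop where
  injective : Function.Injective γ
  measurableSet : ∀ i, MeasurableSet (C i)
  disjoint : Pairwise fun i j => Disjoint (C i) (C j)
  cover : ⋃ i, C i = Set.univ
  nearest : ∀ i, ∀ z ∈ C i, ∀ j, dist z (γ i) ≤ dist z (γ j)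

/-- The quantizer `∑ i, γ i 1_{C i}(Y)` of the random vector `Y`. -/
def quantizer {N : ℕ} (γ : Fin N → EuclideanSpace ℝ ι) (C : Fin N → Set (EuclideanSpace ℝ ι))
    (Y : Ω → EuclideanSpace ℝ ι) (ω : Ω) : EuclideanSpace ℝ ι :=
  ∑ i, (C i).indicator (fun _ => γ i) (Y ω)

/-- `Yhat` is a stationary quantizer of `Y`: `Yhat = 𝔼[Y | Yhat]` almost surely. -/
def IsStationary (P : Measure Ω) (Y Yhat : Ω → EuclideanSpace ℝ ι) : Prop :=
  Yhat =ᵐ[P] P[Y | MeasurableSpace.comap Yhat inferInstance]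

end Quantization

end GaussianStrat

end

/-! Limits in probability of centered Gaussians from a common Gaussian space are `L²` limits, so
each `Z i` lies in the closed Gaussian space spanned by `X`
(`IsStochasticIntegral.exists_mem_closure_span`). Projecting onto the closed span of the past splits
`Z` into a past-measurable `Y` plus a Gaussian residual `R` independent of the past
(`exists_gaussian_regression`). The conditional covariance is then the deterministic covariance of
`R` (`condCovMatrix_ae_eq_of_indep`), so its invertibility gives `R` full support.

Whatever the past, `Y + R` thus enters any nonempty open set with positive conditional probability
(`measure_eq_zero_of_indep_add_mem_open`). Each Voronoi cell contains such a set, so no non-null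
past event is almost surely disjoint from the cell event. -/

namespace GaussianStrat

/-! ### Gaussian subspaces of `L²` -/

section GaussianSubspace

variable {Ω : Type*} {mΩ : MeasurableSpace Ω} {P : Measure Ω}

/-- A subspace of `L²` all of whose elements are centered Gaussian random variables. -/
def IsGaussianSubspace (P : Measure Ω) (K : Submodule ℝ (Lp ℝ 2 P)) : Prop :=
  ∀ w ∈ K, P.map w = gaussianReal 0 (‖w‖₊ ^ 2)

theorem charFun_map_apply_real {f : Ω → ℝ} (hf : AEMeasurable f P) (t : ℝ) :
    charFun (P.map f) t = ∫ ω, Complex.exp (t * f ω * Complex.I) ∂P := by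
  rw [charFun_apply_real, integral_map hf (by fun_prop)]

/-- Dominated convergence, the integrand having modulus one. The general filter `l` allows for the
double limits of a Cauchy argument. -/
theorem tendsto_charFun_map_of_tendsto_ae [IsFiniteMeasure P] {α : Type*} {l : Filter α}
    [l.IsCountablyGenerated] {f : α → Ω → ℝ} {g : Ω → ℝ} (hf : ∀ a, AEMeasurable (f a) P)
    (hg : AEMeasurable g P) (h : ∀ᵐ ω ∂P, Tendsto (fun a => f a ω) l (𝓝 (g ω))) (t : ℝ) :
    Tendsto (fun a => charFun (P.map (f a)) t) l (𝓝 (charFun (P.map g) t)) := by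
  simp_rw [charFun_map_apply_real hg, fun a => charFun_map_apply_real (hf a)]
  refine tendsto_integral_filter_of_dominated_convergence (fun _ => 1) ?_ ?_
    (integrable_const _) ?_
  · refine Eventually.of_forall fun a => AEMeasurable.aestronglyMeasurable ?_
    have := hf a
    fun_prop
  · refine Eventually.of_forall fun a => Eventually.of_forall fun ω => ?_
    rw [← Complex.ofReal_mul, Complex.norm_exp_ofReal_mul_I]
  · filter_upwards [h] with ω hω
    have hc : Continuous fun x : ℝ => Complex.exp (t * x * Complex.I) := by fun_prop
    exact (hc.tendsto _).comp hω

theorem IsGaussianSubspace.charFun_eq {K : Submodule ℝ (Lp ℝ 2 P)} (hK : IsGaussianSubspace P K)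
    {w : Lp ℝ 2 P} (hw : w ∈ K) (t : ℝ) :
    charFun (P.map w) t = (Real.exp (-(‖w‖ ^ 2 * t ^ 2 / 2)) : ℝ) := by
  rw [hK w hw, charFun_gaussianReal]
  simp

/-- Norms converge along an `L²`-convergent sequence, hence so do the Gaussian characteristic
functions; an almost surely convergent subsequence identifies their limit with that of `w`. -/
theorem IsGaussianSubspace.topologicalClosure [IsProbabilityMeasure P]
    {K : Submodule ℝ (Lp ℝ 2 P)} (hK : IsGaussianSubspace P K) :
    IsGaussianSubspace P K.topologicalClosure := by
  intro w hw
  obtain ⟨v, hvK, hv⟩ := mem_closure_iff_seq_limit.1 (show w ∈ closure (K : Set (Lp ℝ 2 P)) from hw)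
  obtain ⟨ns, hns, hae⟩ := (tendstoInMeasure_of_tendsto_Lp hv).exists_seq_tendsto_ae
  have hm : ∀ u : Lp ℝ 2 P, AEMeasurable u P := fun u => (Lp.aestronglyMeasurable u).aemeasurable
  have : IsProbabilityMeasure (P.map w) := Measure.isProbabilityMeasure_map (hm w)
  refine Measure.ext_of_charFun (funext fun t => ?_)
  refine tendsto_nhds_unique
    (tendsto_charFun_map_of_tendsto_ae (fun n => hm (v (ns n))) (hm w) hae t) ?_
  have h1 : Tendsto (fun n => ((Real.exp (-(‖v (ns n)‖ ^ 2 * t ^ 2 / 2)) : ℝ) : ℂ)) atTop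
      (𝓝 ((Real.exp (-(‖w‖ ^ 2 * t ^ 2 / 2)) : ℝ) : ℂ)) := by
    have hc : Continuous fun u : Lp ℝ 2 P => ((Real.exp (-(‖u‖ ^ 2 * t ^ 2 / 2)) : ℝ) : ℂ) := by
      fun_prop
    exact (hc.tendsto w).comp (hv.comp hns.tendsto_atTop)
  convert h1 using 2 with n
  · exact hK.charFun_eq (hvK _) t
  · rw [charFun_gaussianReal]
    simp

theorem IsGaussianSubspace.hasGaussianLaw {K : Submodule ℝ (Lp ℝ 2 P)}
    (hK : IsGaussianSubspace P K) {w : Lp ℝ 2 P} (hw : w ∈ K) : HasGaussianLaw w P where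
  isGaussian_map := by
    rw [hK w hw]
    infer_instance

theorem IsGaussianSubspace.integral_eq_zero {K : Submodule ℝ (Lp ℝ 2 P)}
    (hK : IsGaussianSubspace P K) {w : Lp ℝ 2 P} (hw : w ∈ K) : ∫ ω, w ω ∂P = 0 := by
  have h := integral_map (Lp.aestronglyMeasurable w).aemeasurable
    (f := id) (μ := P) aestronglyMeasurable_id
  simp only [id] at h
  rw [← h, hK w hw]
  exact integral_id_gaussianReal

theorem _root_.ProbabilityTheory.hasGaussianLaw_of_forall_dual {E : Type*} [NormedAddCommGroup E]
    [NormedSpace ℝ E] [MeasurableSpace E] [BorelSpace E] {Y : Ω → E} (hY : AEMeasurable Y P)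
    (h : ∀ L : StrongDual ℝ E, HasGaussianLaw (fun ω => L (Y ω)) P) : HasGaussianLaw Y P where
  isGaussian_map := ⟨fun L => by
    have hL := (h L).map_eq_gaussianReal
    rw [AEMeasurable.map_map_of_aemeasurable (by fun_prop) hY, integral_map hY (by fun_prop),
      variance_map (by fun_prop) hY]
    exact hL⟩

/-- Any linear form in finitely many elements of `K` is again an element of `K`, hence Gaussian. -/
theorem IsGaussianSubspace.isGaussianProcess [IsProbabilityMeasure P]
    {K : Submodule ℝ (Lp ℝ 2 P)} (hK : IsGaussianSubspace P K) :
    IsGaussianProcess (fun (w : K) ω => (w : Lp ℝ 2 P) ω) P where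
  hasGaussianLaw I := by
    classical
    refine hasGaussianLaw_of_forall_dual ?_ fun L => ?_
    · exact aemeasurable_pi_lambda _ fun i => (Lp.aestronglyMeasurable (i : K).1).aemeasurable
    · have hmem : ∑ i : I, L (Pi.single i 1) • ((i : K) : Lp ℝ 2 P) ∈ K :=
        K.sum_mem fun i _ => K.smul_mem _ i.1.2
      refine (hK.hasGaussianLaw hmem).congr ?_
      have h1 := Lp.coeFn_finsetSum (p := 2) (μ := P) Finset.univ
        (fun i : I => L (Pi.single i 1) • ((i : K) : Lp ℝ 2 P))
      have h2 : ∀ᵐ ω ∂P, ∀ i : I, (L (Pi.single i 1) • ((i : K) : Lp ℝ 2 P) : Lp ℝ 2 P) ω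
          = L (Pi.single i 1) * ((i : K) : Lp ℝ 2 P) ω :=
        ae_all_iff.2 fun i => Lp.coeFn_smul _ _
      filter_upwards [h1, h2] with ω h1 h2
      rw [h1]
      have := L.toLinearMap.pi_apply_eq_sum_univ (Finset.restrict I fun w => (w : Lp ℝ 2 P) ω)
      simp only [ContinuousLinearMap.coe_coe] at this
      rw [this, Finset.sum_apply]
      refine Finset.sum_congr rfl fun i _ => ?_
      rw [h2 i, smul_eq_mul, mul_comm]
      refine congrArg₂ (· * ·) rfl (congrArg L ?_)
      ext j
      simp [Pi.single_apply, eq_comm]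

/-- A limit in probability of elements of a closed Gaussian subspace lies in that subspace. -/
theorem IsGaussianSubspace.exists_ae_eq_of_tendstoInMeasure [IsProbabilityMeasure P]
    {K : Submodule ℝ (Lp ℝ 2 P)} (hK : IsGaussianSubspace P K)
    (hKc : IsClosed (K : Set (Lp ℝ 2 P))) {w : ℕ → Lp ℝ 2 P} (hw : ∀ n, w n ∈ K) {Z : Ω → ℝ}
    (hZ : TendstoInMeasure P (fun n => (w n : Ω → ℝ)) atTop Z) :
    ∃ z ∈ K, Z =ᵐ[P] z := by
  obtain ⟨ns, hns, hae⟩ := hZ.exists_seq_tendsto_ae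
  have hm : ∀ u : Lp ℝ 2 P, AEMeasurable u P := fun u => (Lp.aestronglyMeasurable u).aemeasurable
  have h0 : ∀ᵐ ω ∂P, Tendsto (fun a : ℕ × ℕ => (w (ns a.1) - w (ns a.2) : Lp ℝ 2 P) ω)
      (atTop ×ˢ atTop) (𝓝 0) := by
    have hsub : ∀ᵐ ω ∂P, ∀ a : ℕ × ℕ, (w (ns a.1) - w (ns a.2) : Lp ℝ 2 P) ω
        = w (ns a.1) ω - w (ns a.2) ω := ae_all_iff.2 fun a => Lp.coeFn_sub _ _
    filter_upwards [hae, hsub] with ω h1 h2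
    simp_rw [h2]
    have := (h1.comp (tendsto_fst (g := (atTop : Filter ℕ)))).sub
      (h1.comp (tendsto_snd (f := (atTop : Filter ℕ))))
    simpa using this
  -- The differences tend to `0` almost surely, so `exp (-‖difference‖² / 2)` tends to `1`; taking
  -- logarithms makes the subsequence Cauchy in `L²`.
  have h1 := tendsto_charFun_map_of_tendsto_ae (fun a : ℕ × ℕ => hm (w (ns a.1) - w (ns a.2)))
    aemeasurable_const h0 1
  simp_rw [hK.charFun_eq (K.sub_mem (hw _) (hw _))] at h1
  have h2 : Tendsto (fun a : ℕ × ℕ => Real.exp (-(‖w (ns a.1) - w (ns a.2)‖ ^ 2 * 1 ^ 2 / 2)))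
      (atTop ×ˢ atTop) (𝓝 1) := by
    have := (Complex.continuous_re.tendsto _).comp h1
    simp only [Function.comp_def, Complex.ofReal_re] at this
    simpa [charFun_apply_real] using this
  have h3 : Tendsto (fun a : ℕ × ℕ => ‖w (ns a.1) - w (ns a.2)‖) (atTop ×ˢ atTop) (𝓝 0) := by
    have hl := (Real.continuousAt_log one_ne_zero).tendsto.comp h2
    have := (hl.const_mul (-2)).sqrt
    simp only [Function.comp_def, Real.log_exp, Real.log_one] at this
    convert this using 2 with a
    · rw [show (-2 : ℝ) * -(‖w (ns a.1) - w (ns a.2)‖ ^ 2 * 1 ^ 2 / 2)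
        = ‖w (ns a.1) - w (ns a.2)‖ ^ 2 by ring, Real.sqrt_sq (norm_nonneg _)]
    · simp
  have hc : CauchySeq fun n => w (ns n) := by
    rw [cauchySeq_iff_tendsto_dist_atTop_0, ← prod_atTop_atTop_eq]
    simpa [dist_eq_norm] using h3
  obtain ⟨z, hz⟩ := cauchySeq_tendsto_of_complete hc
  refine ⟨z, hKc.mem_of_tendsto hz (Eventually.of_forall fun n => hw _), ?_⟩
  exact tendstoInMeasure_ae_unique (hZ.comp hns.tendsto_atTop) (tendstoInMeasure_of_tendsto_Lp hz)

theorem isGaussianSubspace_span [IsProbabilityMeasure P] {S : Type*} {X : S → Ω → ℝ}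
    (hX : IsGaussianProcess X P) (hX0 : ∀ t, ∫ ω, X t ω ∂P = 0) {x : S → Lp ℝ 2 P}
    (hx : ∀ t, x t =ᵐ[P] X t) :
    IsGaussianSubspace P (Submodule.span ℝ (Set.range x)) := by
  intro w hw
  obtain ⟨c, rfl⟩ := Finsupp.mem_span_range_iff_exists_finsupp.1 hw
  set v : Lp ℝ 2 P := c.sum fun i a => a • x i with hv
  have hvX : v =ᵐ[P] fun ω => ∑ i ∈ c.support, c i * X i ω := by
    have h1 := Lp.coeFn_finsetSum (p := 2) (μ := P) c.support (fun i => c i • x i)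
    have h2 : ∀ᵐ ω ∂P, ∀ i : c.support, (c i • x i : Lp ℝ 2 P) ω = c i * X i ω :=
      ae_all_iff.2 fun i => by
        filter_upwards [Lp.coeFn_smul (c i) (x i), hx i] with ω h h'
        rw [h, Pi.smul_apply, h', smul_eq_mul]
    filter_upwards [h1, h2] with ω h1 h2
    rw [hv, Finsupp.sum, h1, Finset.sum_apply]
    exact Finset.sum_congr rfl fun i hi => h2 ⟨i, hi⟩
  have hG : HasGaussianLaw v P :=
    ((hX.smul c).hasGaussianLaw_fun_sum (I := c.support)).congr hvX.symm
  have hI : ∫ ω, v ω ∂P = 0 := by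
    rw [integral_congr_ae hvX, integral_finsetSum]
    · simp [integral_const_mul, hX0]
    · exact fun i _ => (hX.hasGaussianLaw_eval i).integrable.const_mul _
  rw [hG.map_eq_gaussianReal, hI]
  congr 1
  rw [variance_of_integral_eq_zero hG.aemeasurable hI]
  have : ∫ ω, v ω ^ 2 ∂P = ‖v‖ ^ 2 := by
    rw [← real_inner_self_eq_norm_sq, L2.inner_def]
    simp [pow_two]
  rw [this]
  ext
  simp

end GaussianSubspace

end GaussianStrat

namespace GaussianStrat

/-! ### Gaussian regression and full support -/

section Regression

variable {Ω : Type*} {m mΩ : MeasurableSpace Ω} {P : Measure Ω} {ι : Type*}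

/-- `y` is the orthogonal projection of `z` onto the closed span `H` of the past. The residual is
orthogonal to `H` and jointly Gaussian with the past, so zero covariance becomes independence. -/
theorem exists_gaussian_regression [IsProbabilityMeasure P] (hle : m ≤ mΩ) {S : Type*}
    {X : S → Ω → ℝ} (s : Set S) (hXm : ∀ t ∈ s, Measurable[m] (X t))
    (hX : IsGaussianProcess X P) (hX0 : ∀ t, ∫ ω, X t ω ∂P = 0) {x : S → Lp ℝ 2 P}
    (hx : ∀ t, x t =ᵐ[P] X t) {z : ι → Lp ℝ 2 P}
    (hz : ∀ i, z i ∈ (Submodule.span ℝ (Set.range x)).topologicalClosure) :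
    ∃ y r : ι → Lp ℝ 2 P, (∀ i, z i = y i + r i) ∧
      (∀ i, AEStronglyMeasurable[m] (y i) P) ∧
      (∀ i, r i ∈ (Submodule.span ℝ (Set.range x)).topologicalClosure) ∧
      IndepFun (fun ω (t : s) => X t ω) (fun ω i => r i ω) P := by
  set K := (Submodule.span ℝ (Set.range x)).topologicalClosure
  have hK : IsGaussianSubspace P K := (isGaussianSubspace_span hX hX0 hx).topologicalClosure
  set H := (Submodule.span ℝ (x '' s)).topologicalClosure
  have hHK : H ≤ K := Submodule.topologicalClosure_mono
    (Submodule.span_mono (Set.image_subset_range x s))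
  have hxH : ∀ t ∈ s, x t ∈ H := fun t ht =>
    Submodule.le_topologicalClosure _ (Submodule.subset_span ⟨t, ht, rfl⟩)
  have hxK : ∀ t, x t ∈ K := fun t =>
    Submodule.le_topologicalClosure _ (Submodule.subset_span ⟨t, rfl⟩)
  have hHm : H ≤ lpMeas ℝ ℝ m 2 P := by
    refine Submodule.topologicalClosure_minimal _ (Submodule.span_le.2 ?_)
      (isClosed_aestronglyMeasurable hle)
    rintro _ ⟨t, ht, rfl⟩
    refine mem_lpMeas_iff_aestronglyMeasurable.2 ⟨X t, (hXm t ht).stronglyMeasurable, hx t⟩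
  have : CompleteSpace H := (Submodule.isClosed_topologicalClosure _).completeSpace_coe
  have hrK : ∀ i, z i - H.starProjection (z i) ∈ K := fun i =>
    K.sub_mem (hz i) (hHK (H.starProjection_apply_mem _))
  refine ⟨fun i => H.starProjection (z i), fun i => z i - H.starProjection (z i), fun i => by simp,
    fun i => mem_lpMeas_iff_aestronglyMeasurable.1 (hHm (H.starProjection_apply_mem _)), hrK, ?_⟩
  have hproc : IsGaussianProcess
      (Sum.elim (fun (t : s) => X t) (fun i ω => (z i - H.starProjection (z i) : Lp ℝ 2 P) ω)) P := by
    refine (hK.isGaussianProcess.comp_right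
      (Sum.elim (fun t : s => (⟨x t, hxK t⟩ : K)) fun i => ⟨_, hrK i⟩)).congr ?_
    rintro (t | i)
    · exact hx t
    · rfl
  refine hproc.indepFun_of_covariance_eq_zero (fun t => hX.aemeasurable t)
    (fun i => (Lp.aestronglyMeasurable _).aemeasurable) fun t i => ?_
  have horth := (H.mem_orthogonal (z i - H.starProjection (z i))).1
    (H.sub_starProjection_mem_orthogonal _) (x t) (hxH t t.2)
  rw [L2.inner_def] at horth
  rw [covariance_eq_sub (hX.hasGaussianLaw_eval t).memLp_two (hK.hasGaussianLaw (hrK i)).memLp_two,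
    hX0, zero_mul, sub_zero, ← horth]
  refine integral_congr_ae ?_
  filter_upwards [hx t] with ω h
  simp [h, mul_comm]

/-- Conditioning on `m` fixes `y` and averages `r` to `0`, so the conditional residual of `Z` is
`r`, whose products are independent of `m`. -/
theorem condCovMatrix_ae_eq_of_indep [Fintype ι] [IsProbabilityMeasure P]
    (hm : m ≤ mΩ) {Z y r : ι → Ω → ℝ} (hZ : ∀ i, Z i =ᵐ[P] y i + r i)
    (hy : ∀ i, AEStronglyMeasurable[m] (y i) P) (hyi : ∀ i, Integrable (y i) P)
    (hr : ∀ i, Measurable (r i)) (hri : ∀ i, Integrable (r i) P) (hr0 : ∀ i, ∫ ω, r i ω ∂P = 0)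
    (hind : Indep m (.comap (fun ω i => r i ω) inferInstance) P) :
    condCovMatrix P m Z =ᵐ[P] fun _ => Matrix.of fun i j => ∫ ω, r i ω * r j ω ∂P := by
  have hrm : Measurable fun ω i => r i ω := measurable_pi_lambda _ hr
  have hcoord : ∀ i, Measurable[.comap (fun ω i => r i ω) inferInstance] (r i) := fun i =>
    (measurable_pi_apply i).comp (comap_measurable (fun ω i => r i ω))
  have hres : ∀ i, Z i - P[Z i | m] =ᵐ[P] r i := by
    intro i
    have h1 := condExp_congr_ae (m := m) (hZ i)
    have h2 := condExp_add (hyi i) (hri i) m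
    have h3 := condExp_of_aestronglyMeasurable' hm (hy i) (hyi i)
    have h4 := condExp_indep_eq hrm.comap_le hm (hcoord i).stronglyMeasurable hind.symm
    filter_upwards [hZ i, h1, h2, h3, h4] with ω h h1 h2 h3 h4
    simp only [Pi.sub_apply, Pi.add_apply] at *
    rw [h, h1, h2, h3, h4, hr0]
    ring
  have hentry : ∀ i j, P[fun ω' => (Z i ω' - (P[Z i | m]) ω') * (Z j ω' - (P[Z j | m]) ω') | m]
      =ᵐ[P] fun _ => ∫ ω, r i ω * r j ω ∂P := by
    intro i j
    have h1 := condExp_congr_ae (m := m) ((hres i).mul (hres j))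
    have h2 := condExp_indep_eq hrm.comap_le hm
      ((hcoord i).mul (hcoord j)).stronglyMeasurable hind.symm
    exact h1.trans h2
  filter_upwards [ae_all_iff.2 fun i => ae_all_iff.2 (hentry i)] with ω h
  ext i j
  exact h i j

-- The law is the image of the standard Gaussian under `v ↦ μ + √S v`, a continuous map that is onto
-- because `√S` is invertible.
open scoped MatrixOrder Matrix.Norms.L2Operator in
theorem _root_.ProbabilityTheory.isOpenPosMeasure_multivariateGaussian [Fintype ι] [DecidableEq ι]
    (μ : EuclideanSpace ℝ ι) {S : Matrix ι ι ℝ} (hS : S.PosSemidef) (hu : IsUnit S) :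
    (multivariateGaussian μ S).IsOpenPosMeasure := by
  have h1 : (gaussianReal 0 1).IsOpenPosMeasure :=
    (gaussianReal_absolutelyContinuous' 0 one_ne_zero).isOpenPosMeasure
  have h2 : (stdGaussian (EuclideanSpace ℝ ι)).IsOpenPosMeasure := by
    rw [← map_pi_eq_stdGaussian]
    exact (PiLp.continuous_toLp 2 _).isOpenPosMeasure_map (WithLp.toLp_surjective 2)
  have h3 : IsUnit (CFC.sqrt S) := (CFC.isUnit_sqrt_iff S hS.nonneg).2 hu
  obtain ⟨B, hB⟩ := h3.exists_right_inv
  rw [multivariateGaussian]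
  refine Continuous.isOpenPosMeasure_map (by fun_prop) fun v => ?_
  refine ⟨Matrix.toEuclideanCLM (𝕜 := ℝ) B (v - μ), ?_⟩
  have := congrArg (fun M => Matrix.toEuclideanCLM (𝕜 := ℝ) M (v - μ)) hB
  simp only [map_mul, map_one, mul_apply_eq_comp, one_apply_eq_self] at this
  rw [this]
  abel

theorem IsGaussianSubspace.isOpenPosMeasure_map [Fintype ι] [DecidableEq ι]
    [IsProbabilityMeasure P] {K : Submodule ℝ (Lp ℝ 2 P)} (hK : IsGaussianSubspace P K)
    {r : ι → Lp ℝ 2 P} (hr : ∀ i, r i ∈ K)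
    (hu : IsUnit (Matrix.of fun i j => ∫ ω, r i ω * r j ω ∂P)) :
    (P.map (vec fun i => r i)).IsOpenPosMeasure := by
  set S : Matrix ι ι ℝ := Matrix.of fun i j => ∫ ω, r i ω * r j ω ∂P
  have hSinner : ∀ i j, S i j = inner ℝ (r i) (r j) := by
    intro i j
    rw [L2.inner_def]
    simp [S, mul_comm]
  -- This Gram identity gives both positive semidefiniteness of `S` and the exponent of the
  -- characteristic function.
  have hnorm : ∀ t : ι → ℝ, t ⬝ᵥ S.mulVec t = ‖∑ i, t i • r i‖ ^ 2 := by
    intro t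
    rw [← real_inner_self_eq_norm_sq, sum_inner]
    simp_rw [inner_sum, inner_smul_left, inner_smul_right, dotProduct, Matrix.mulVec, dotProduct,
      hSinner, Finset.mul_sum]
    simp [mul_comm]
  have hS : S.PosSemidef := by
    refine Matrix.PosSemidef.of_dotProduct_mulVec_nonneg ?_ fun t => ?_
    · ext i j
      simp [hSinner, real_inner_comm]
    · rw [star_trivial, hnorm]
      positivity
  have hm : AEMeasurable (vec fun i => (r i : Ω → ℝ)) P := by
    refine Measurable.aemeasurable ?_
    exact (WithLp.measurable_toLp 2 _).comp
      (measurable_pi_lambda _ fun i => (Lp.stronglyMeasurable (r i)).measurable)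
  have : IsProbabilityMeasure (P.map (vec fun i => (r i : Ω → ℝ))) :=
    Measure.isProbabilityMeasure_map hm
  suffices h : P.map (vec fun i => (r i : Ω → ℝ)) = multivariateGaussian 0 S by
    rw [h]
    exact isOpenPosMeasure_multivariateGaussian 0 hS hu
  refine Measure.ext_of_charFun (funext fun t => ?_)
  have hmem : ∑ i, t i • r i ∈ K := K.sum_mem fun i _ => K.smul_mem _ (hr i)
  have hae : ∀ᵐ ω ∂P, (∑ i, t i • r i : Lp ℝ 2 P) ω = inner ℝ (vec (fun i => r i) ω) t := by
    have h1 := Lp.coeFn_finsetSum (p := 2) (μ := P) Finset.univ (fun i => t i • r i)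
    have h2 : ∀ᵐ ω ∂P, ∀ i, (t i • r i : Lp ℝ 2 P) ω = t i * r i ω :=
      ae_all_iff.2 fun i => Lp.coeFn_smul _ _
    filter_upwards [h1, h2] with ω h1 h2
    rw [h1, Finset.sum_apply]
    simp [h2, vec, PiLp.inner_apply]
  rw [charFun_multivariateGaussian hS, charFun_apply, integral_map hm (by fun_prop)]
  have h1 := hK.charFun_eq hmem 1
  rw [charFun_map_apply_real (Lp.aestronglyMeasurable _).aemeasurable] at h1
  have h2 : ∫ ω, Complex.exp (inner ℝ (vec (fun i => r i) ω) t * Complex.I) ∂P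
      = ∫ ω, Complex.exp ((1 : ℝ) * (∑ i, t i • r i : Lp ℝ 2 P) ω * Complex.I) ∂P := by
    refine integral_congr_ae ?_
    filter_upwards [hae] with ω h
    rw [h, Complex.ofReal_one, one_mul]
  rw [h2, h1, ← hnorm]
  simp

/-- Adding to an `m`-measurable vector an independent one with full support produces a vector that
visits every nonempty open set with positive probability on each non-null event of `m`. -/
theorem measure_eq_zero_of_indep_add_mem_open [IsProbabilityMeasure P] {E : Type*}
    [NormedAddCommGroup E] [MeasurableSpace E] [BorelSpace E] [SecondCountableTopology E]
    (hm : m ≤ mΩ) {Y R : Ω → E} (hY : Measurable[m] Y)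
    (hR : Measurable R) (hind : Indep m (.comap R inferInstance) P)
    (hpos : (P.map R).IsOpenPosMeasure) {U : Set E} (hU : IsOpen U) (hUne : U.Nonempty)
    {A : Set Ω} (hA : MeasurableSet[m] A) (h0 : P (A ∩ {ω | Y ω + R ω ∈ U}) = 0) : P A = 0 := by
  set g : Ω → ℝ × E := fun ω => (A.indicator (fun _ => 1) ω, Y ω) with hg
  have hgm : Measurable[m] g := (measurable_const.indicator hA).prodMk hY
  have hgm' : Measurable g := hgm.mono hm le_rfl
  have hgR : IndepFun g R P := by
    rw [IndepFun_iff_Indep]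
    exact indep_of_indep_of_le_left hind hgm.comap_le
  have hB : MeasurableSet {p : (ℝ × E) × E | p.1.1 = 1 ∧ p.1.2 + p.2 ∈ U} := by
    refine MeasurableSet.inter ?_ ?_
    · exact measurableSet_eq_fun (by fun_prop) measurable_const
    · exact (show Measurable fun p : (ℝ × E) × E => p.1.2 + p.2 by fun_prop) hU.measurableSet
  have hlaw := (indepFun_iff_map_prod_eq_prod_map_map hgm'.aemeasurable hR.aemeasurable).1 hgR
  have hnull : ((P.map g).prod (P.map R)) {p | p.1.1 = 1 ∧ p.1.2 + p.2 ∈ U} = 0 := by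
    rw [← hlaw, Measure.map_apply (hgm'.prodMk hR) hB]
    refine measure_mono_null ?_ h0
    rintro ω ⟨h1, h2⟩
    refine ⟨?_, h2⟩
    by_contra hω
    simp [hg, hω] at h1
  -- By Fubini almost every section is null; over a point of `A` the section is a translate of `U`,
  -- which full support forbids.
  rw [Measure.measure_prod_null hB] at hnull
  have hae := ae_of_ae_map hgm'.aemeasurable hnull
  rw [measure_eq_zero_iff_ae_notMem]
  filter_upwards [hae] with ω h hω
  have hopen : IsOpen ((fun v => Y ω + v) ⁻¹' U) := hU.preimage (by fun_prop)
  have hne : ((fun v => Y ω + v) ⁻¹' U).Nonempty :=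
    hUne.preimage (add_left_surjective (Y ω))
  refine hopen.measure_ne_zero (P.map R) hne ?_
  have : (fun v => Y ω + v) ⁻¹' U = Prod.mk (g ω) ⁻¹' {p | p.1.1 = 1 ∧ p.1.2 + p.2 ∈ U} := by
    ext v
    simp [hg, hω]
  rw [this]
  exact h

end Regression

/-! ### Voronoi cells -/

section Quantization

variable {Ω : Type*} {ι : Type*} [Fintype ι] {N : ℕ}
  {γ : Fin N → EuclideanSpace ℝ ι} {C : Fin N → Set (EuclideanSpace ℝ ι)}

theorem quantizer_eq_of_mem (hC : IsVoronoiPartition γ C) {Y : Ω → EuclideanSpace ℝ ι} {ω : Ω}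
    {k : Fin N} (h : Y ω ∈ C k) : quantizer γ C Y ω = γ k := by
  rw [quantizer, Finset.sum_eq_single k]
  · simp [h]
  · intro j _ hj
    have : Y ω ∉ C j := fun h' => Set.disjoint_left.1 (hC.disjoint hj) h' h
    simp [this]
  · simp

/-- Each Voronoi cell contains a nonempty open set. -/
theorem IsVoronoiPartition.exists_isOpen_subset (hC : IsVoronoiPartition γ C) (k : Fin N) :
    ∃ U, IsOpen U ∧ U.Nonempty ∧ U ⊆ C k := by
  -- The open set is where `γ k` is the strictly nearest knot, so no other cell can meet it.
  refine ⟨⋂ j : {j // j ≠ k}, {z | dist z (γ k) < dist z (γ j)}, ?_, ⟨γ k, ?_⟩, fun z hz => ?_⟩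
  · exact isOpen_iInter_of_finite fun j => isOpen_lt (by fun_prop) (by fun_prop)
  · refine Set.mem_iInter.2 fun j => ?_
    simpa using fun h => j.2 (hC.injective h).symm
  · obtain ⟨j, hj⟩ := Set.mem_iUnion.1 (hC.cover.ge (Set.mem_univ z))
    by_cases hjk : j = k
    · exact hjk ▸ hj
    · exact absurd (hC.nearest j z hj k) (not_le.2 (Set.mem_iInter.1 hz ⟨j, hjk⟩))

end Quantization

end GaussianStrat

namespace GaussianStrat

/-! ### Stochastic integrals in the Gaussian space -/

section Integration

variable {T : ℝ} [Fact (0 < T)] {Ω : Type*} {mΩ : MeasurableSpace Ω} {P : Measure Ω}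

/-- The stochastic integral of a deterministic function is a limit in probability of linear
combinations of the integrator, hence lies in the Gaussian space it generates. -/
theorem IsStochasticIntegral.exists_mem_closure_span [IsProbabilityMeasure P]
    {𝔽 : Filtration (Time T) mΩ} {X : Time T → Ω → ℝ} (hX : IsGaussianProcess X P)
    (hX0 : ∀ t, ∫ ω, X t ω ∂P = 0) {x : Time T → Lp ℝ 2 P} (hx : ∀ t, x t =ᵐ[P] X t)
    {f : Time T → ℝ} {Z : Ω → ℝ} (hZ : IsStochasticIntegral 𝔽 P X f Z) :
    ∃ z ∈ (Submodule.span ℝ (Set.range x)).topologicalClosure, Z =ᵐ[P] z := by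
  obtain ⟨-, -, -, -, -, h, -, -, hlim⟩ := hZ
  have hK := (isGaussianSubspace_span hX hX0 hx).topologicalClosure
  have hxK : ∀ t, x t ∈ (Submodule.span ℝ (Set.range x)).topologicalClosure := fun t =>
    Submodule.le_topologicalClosure _ (Submodule.subset_span ⟨t, rfl⟩)
  refine hK.exists_ae_eq_of_tendstoInMeasure (Submodule.isClosed_topologicalClosure _)
    (w := fun n => ∑ i, (h n).c i • (x ((h n).b i) - x ((h n).a i)))
    (fun n => Submodule.sum_mem _ fun i _ =>
      Submodule.smul_mem _ _ (Submodule.sub_mem _ (hxK _) (hxK _))) ?_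
  refine hlim.congr_left fun n => ?_
  have h1 := Lp.coeFn_finsetSum (p := 2) (μ := P) Finset.univ
    (fun i => (h n).c i • (x ((h n).b i) - x ((h n).a i)))
  have h2 : ∀ᵐ ω ∂P, ∀ i, ((h n).c i • (x ((h n).b i) - x ((h n).a i)) : Lp ℝ 2 P) ω
      = (h n).c i * (X ((h n).b i) ω - X ((h n).a i) ω) := ae_all_iff.2 fun i => by
    filter_upwards [Lp.coeFn_smul ((h n).c i) (x ((h n).b i) - x ((h n).a i)),
      Lp.coeFn_sub (x ((h n).b i)) (x ((h n).a i)), hx ((h n).b i), hx ((h n).a i)]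
      with ω h3 h4 h5 h6
    rw [h3, Pi.smul_apply, h4, Pi.sub_apply, h5, h6, smul_eq_mul]
  filter_upwards [h1, h2] with ω h1 h2
  rw [h1, Finset.sum_apply, StepFunction.integral]
  exact Finset.sum_congr rfl fun i _ => (h2 i).symm

end Integration

/-! ### Past events against the terminal vector -/

section MainArgument

variable {Ω : Type*} {mΩ : MeasurableSpace Ω} {P : Measure Ω} {ι : Type*} [Fintype ι]
  [DecidableEq ι]

/-- Past events of positive probability are not excluded by the terminal vector `Z` lying in a
given nonempty open set, provided that the conditional covariance matrix of `Z` is invertible. -/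
theorem measure_eq_zero_of_measure_inter_vec_mem_open [IsProbabilityMeasure P] {S : Type*}
    {X : S → Ω → ℝ} (hXm : ∀ t, Measurable (X t)) (hX : IsGaussianProcess X P)
    (hX0 : ∀ t, ∫ ω, X t ω ∂P = 0) {x : S → Lp ℝ 2 P} (hx : ∀ t, x t =ᵐ[P] X t) (s : Set S)
    {Z : ι → Ω → ℝ} {z : ι → Lp ℝ 2 P} (hZz : ∀ i, Z i =ᵐ[P] z i)
    (hz : ∀ i, z i ∈ (Submodule.span ℝ (Set.range x)).topologicalClosure)
    (hH : ∀ᵐ ω ∂P, IsUnit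
      (condCovMatrix P (.comap (fun ω (t : s) => X t ω) inferInstance) Z ω))
    {U : Set (EuclideanSpace ℝ ι)} (hU : IsOpen U) (hUne : U.Nonempty) {A : Set Ω}
    (hA : MeasurableSet[.comap (fun ω (t : s) => X t ω) inferInstance] A)
    (h0 : P (A ∩ {ω | vec Z ω ∈ U}) = 0) : P A = 0 := by
  have hm : MeasurableSpace.comap (fun ω (t : s) => X t ω) inferInstance ≤ mΩ :=
    (measurable_pi_lambda _ fun t : s => hXm t).comap_le
  have hK := (isGaussianSubspace_span hX hX0 hx).topologicalClosure
  obtain ⟨y, r, hyr, hy, hr, hind⟩ := exists_gaussian_regression hm s (fun t ht =>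
    (measurable_pi_apply (⟨t, ht⟩ : s)).comp (comap_measurable (fun ω (t : s) => X t ω)))
    hX hX0 hx hz
  rw [IndepFun_iff_Indep] at hind
  have hrm : ∀ i, Measurable (r i) := fun i => (Lp.stronglyMeasurable (r i)).measurable
  have hZ : ∀ i, Z i =ᵐ[P] (y i : Ω → ℝ) + r i := fun i => by
    have := Lp.coeFn_add (y i) (r i)
    rw [← hyr] at this
    exact (hZz i).trans this
  have hcov := condCovMatrix_ae_eq_of_indep hm hZ hy
    (fun i => (Lp.memLp (y i)).integrable one_le_two) hrm
    (fun i => (Lp.memLp (r i)).integrable one_le_two) (fun i => hK.integral_eq_zero (hr i)) hind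
  -- The conditional covariance is almost surely constant, so a single good `ω₀` makes the
  -- deterministic matrix invertible.
  obtain ⟨ω₀, hω₀, hω₀'⟩ := (hH.and hcov).exists
  rw [hω₀'] at hω₀
  have hpos := hK.isOpenPosMeasure_map hr hω₀
  -- Each `y i` is `m`-measurable only up to a null set; `y'` is a genuinely `m`-measurable version.
  choose y' hy' hyy' using hy
  have hvec : Measurable fun v : ι → ℝ => (WithLp.toLp 2 v : EuclideanSpace ℝ ι) :=
    WithLp.measurable_toLp 2 _
  refine measure_eq_zero_of_indep_add_mem_open (R := vec fun i => r i)
    (Y := fun ω => vec y' ω) hm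
    (hvec.comp (@measurable_pi_lambda _ _ _ (_) _ _ fun i => (hy' i).measurable))
    (hvec.comp (measurable_pi_lambda _ hrm)) ?_ hpos hU hUne hA ?_
  · refine indep_of_indep_of_le_right hind ?_
    exact (hvec.comp (comap_measurable fun ω i => r i ω)).comap_le
  · rw [← h0]
    refine measure_congr ?_
    filter_upwards [ae_all_iff.2 hZ, ae_all_iff.2 hyy'] with ω h1 h2
    have : vec Z ω = vec y' ω + vec (fun i => r i) ω := by
      ext i
      simp [vec, h1 i, h2 i]
    refine propext (and_congr_right fun _ => ?_)
    simp only [Set.mem_ofPred_eq, this]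

end MainArgument

end GaussianStrat

/-! ### Equivalence on the past -/

open GaussianStrat in
theorem mainTheorem8 {T : ℝ} [Fact (0 < T)] {Ω : Type*} {mΩ : MeasurableSpace Ω}
    (P : Measure Ω) [IsProbabilityMeasure P]
    (X : Time T → Ω → ℝ) (hXmeas : ∀ t, StronglyMeasurable (X t))
    (hXcont : HasContinuousPaths X P) (hXstart : ∀ᵐ ω ∂P, X ⊥ ω = 0)
    (hXgauss : IsGaussianProcess X P) (hXcentered : ∀ t, ∫ ω, X t ω ∂P = 0)
    (𝔽 : Filtration (Time T) mΩ) (hXsemi : IsContinuousSemimartingale 𝔽 P X)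
    {ι : Type*} [Fintype ι] [DecidableEq ι]
    (f : ι → Time T → ℝ) (hfmeas : ∀ i, Measurable (f i)) (hfbdd : ∀ i, ∃ K, ∀ t, |f i t| ≤ K)
    (Z : ι → Ω → ℝ) (hZmeas : ∀ i, Measurable (Z i))
    (hZ : ∀ i, IsStochasticIntegral 𝔽 P X (f i) (Z i))
    (hH : ∀ s : Time T, s < ⊤ →
      ∀ᵐ ω ∂P, IsUnit (condCovMatrix P (Filtration.natural X hXmeas s) Z ω))
    {N : ℕ} (γ : Fin N → EuclideanSpace ℝ ι) (C : Fin N → Set (EuclideanSpace ℝ ι))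
    (hC : IsVoronoiPartition γ C)
    (hstat : IsStationary P (vec Z) (quantizer γ C (vec Z))) :
    ∀ s : Time T, s < ⊤ → ∀ k : Fin N,
      0 < P {ω | quantizer γ C (vec Z) ω = γ k} ∧
      (ProbabilityTheory.cond P {ω | quantizer γ C (vec Z) ω = γ k}).trim
          ((Filtration.natural X hXmeas).le s) ≪
        P.trim ((Filtration.natural X hXmeas).le s) ∧
      P.trim ((Filtration.natural X hXmeas).le s) ≪
        (ProbabilityTheory.cond P {ω | quantizer γ C (vec Z) ω = γ k}).trim
          ((Filtration.natural X hXmeas).le s) := by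
  intro s hs k
  have hm : (Filtration.natural X hXmeas s : MeasurableSpace Ω) = .comap (fun ω (t : Set.Iic s) => X t ω) inferInstance :=
    Filtration.natural_eq_comap X hXmeas s
  have hXL : ∀ t, MemLp (X t) 2 P := fun t => (hXgauss.hasGaussianLaw_eval t).memLp_two
  have hx : ∀ t, (hXL t).toLp (X t) =ᵐ[P] X t := fun t => (hXL t).coeFn_toLp
  choose z hz hZz using fun i => (hZ i).exists_mem_closure_span hXgauss hXcentered hx
  obtain ⟨U, hUo, hUne, hUC⟩ := hC.exists_isOpen_subset k
  set E : Set Ω := {ω | quantizer γ C (vec Z) ω = γ k}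
  have hUE : {ω | vec Z ω ∈ U} ⊆ E := fun ω hω => quantizer_eq_of_mem hC (hUC hω)
  -- `A = Set.univ` gives positivity of `P E`; general `A` gives the nontrivial absolute continuity.
  have key : ∀ A, MeasurableSet[Filtration.natural X hXmeas s] A → P (A ∩ E) = 0 → P A = 0 := by
    intro A hA h0
    have hHs := hH s hs
    rw [hm] at hHs
    rw [hm] at hA
    exact measure_eq_zero_of_measure_inter_vec_mem_open (fun t => (hXmeas t).measurable) hXgauss
      hXcentered hx (Set.Iic s) hZz hz hHs hUo hUne hA
      (measure_mono_null (Set.inter_subset_inter_right A hUE) h0)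
  have hpos : 0 < P E := by
    refine pos_iff_ne_zero.2 fun h => ?_
    have := key Set.univ (@MeasurableSet.univ _ _) (by rwa [Set.univ_inter])
    simp at this
  have hZvec : Measurable (vec Z) :=
    (WithLp.measurable_toLp 2 (ι → ℝ)).comp (measurable_pi_lambda _ hZmeas)
  have hEm : MeasurableSet E := by
    have hq : Measurable (quantizer γ C (vec Z)) :=
      Finset.measurable_sum _ fun i _ =>
        (measurable_const.indicator (hC.measurableSet i)).comp hZvec
    exact hq (measurableSet_singleton (γ k))
  refine ⟨hpos, ?_, ?_⟩
  · exact cond_absolutelyContinuous.trim _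
  · refine Measure.AbsolutelyContinuous.mk fun A hA h0 => ?_
    rw [trim_measurableSet_eq _ hA] at h0 ⊢
    rw [cond_apply hEm] at h0
    refine key A hA ?_
    rw [Set.inter_comm]
    exact (mul_eq_zero.1 h0).resolve_left (ENNReal.inv_ne_zero.2 (measure_ne_top P E))
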